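/- Let $M$ be a (connected) Riemann surface, let $n\ge 1$, and let $\underline{\mathbb C}^n=M\times\mathbb C^n$ be the trivial bundle with its standard Hermitian metric. For a smooth map $\phi:M\to \mathrm U(n)$ and a local complex coordinate $z$ put $$A^\phi_z=\tfrac12\phi^{-1}\partial_z\phi,\qquad A^\phi_{\bar z}=\tfrac12\phi^{-1}\partial_{\bar z}\phi,\qquad D^\phi_{\bar z}=\partial_{\bar z}+A^\phi_{\bar z}.$$ The map $\phi$ is harmonic if $\partial_{\bar z}A^\phi_z+[A^\phi_{\bar z},A^\phi_z]=0$ for every such coordinate. A *uniton* for a harmonic map $\phi$ is a smooth subbundle $\alpha\subseteq\underline{\mathbb C}^n$ such that, for every local complex coordinate $z$, $D^\phi_{\bar z}$ and $A^\phi_z$ map sections of $\alpha$ to sections of $\alpha$. Write $\pi_\alpha$ and $\pi_\alpha^\perp$ for the orthogonal projections onto $\alpha$ and $\alpha^\perp$. A *sequence of unitons* $\alpha_1,\dots,\alpha_i$ ($i\ge 0$) starting from a constant $\phi_0\in \mathrm U(n)$ is a sequence of smooth subbundles such that each $\alpha_\ell$ is a uniton for $\phi_{\ell-1}$, where $$\phi_\ell=\phi_0(\pi_{\alpha_1}-\pi_{\alpha_1}^\perp)\cdots(\pi_{\alpha_\ell}-\pi_{\alpha_\ell}^\perp)\qquad(0\le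 \ell\le i).$$ It satisfies the *covering condition* if $\pi_{\alpha_{\ell-1}}\alpha_\ell=\alpha_{\ell-1}$ for $\ell=2,\dots,i$, where equality is required of fibres at all points outside a closed discrete subset of $M$. A subbundle is *full* if it is contained in no constant subbundle $M\times W$ with $W\subsetneq\mathbb C^n$. The *(minimal) uniton number* of a map $\phi:M\to \mathrm U(n)$ that admits such a factorization is the least $r\ge 0$ such that $\phi=\psi_0(\pi_{\beta_1}-\pi_{\beta_1}^\perp)\cdots(\pi_{\beta_r}-\pi_{\beta_r}^\perp)$ for some constant $\psi_0\in\mathrm U(n)$ and some sequence of unitons $\beta_1,\dots,\beta_r$ starting from $\psi_0$. **Statement.** Let $i\ge 0$, let $\phi_0\in \mathrm U(n)$, and let $\alpha_1,\dots,\alpha_i$ be a sequence of unitons starting from $\phi_0$ which satisfies the covering condition. Suppose that no $\alpha_\ell$ $(1\le\ell\le i)$ is the whole bundle $\underline{\mathbb C}^n$ and, if $i\ge1$, that $\alpha_1$ is full. Then $\phi_i=\phi_0(\pi_{\alpha_1}-\pi_{\alpha_1}^\perp)\cdots(\pi_{\alpha_i}-\pi_{\alpha_i}^\perp)$ has uniton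 number exactly $i$. -/

import Mathlib

open scoped Manifold ContDiff

namespace UnitonTheory

noncomputable section

/-- The Hermitian space `ℂⁿ`. -/
abbrev Vec (n : ℕ) : Type := EuclideanSpace ℂ (Fin n)

/-- The algebra `𝔤𝔩(n, ℂ)` of endomorphisms of `ℂⁿ`. -/
abbrev Endo (n : ℕ) : Type := Vec n →L[ℂ] Vec n

/-- The unitary group `U(n)`, as the group of unitary operators of `ℂⁿ`. -/
abbrev UGroup (n : ℕ) : Type := unitary (Endo n)

section Coordinates

variable {M : Type*} [TopologicalSpace M]
variable {F : Type*} [NormedAddCommGroup F] [NormedSpace ℝ F] [NormedSpace ℂ F]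

/-- `∂f/∂z = (1/2) (∂f/∂x - i ∂f/∂y)` at `p`, where `z = x + i y` is the coordinate `e`. -/
def dz (e : OpenPartialHomeomorph M ℂ) (f : M → F) (p : M) : F :=
  (1 / 2 : ℂ) • (fderiv ℝ (f ∘ e.symm) (e p) 1 -
    Complex.I • fderiv ℝ (f ∘ e.symm) (e p) Complex.I)

/-- `∂f/∂z̄ = (1/2) (∂f/∂x + i ∂f/∂y)` at `p`, where `z = x + i y` is the coordinate `e`. -/
def dzbar (e : OpenPartialHomeomorph M ℂ) (f : M → F) (p : M) : F :=
  (1 / 2 : ℂ) • (fderiv ℝ (f ∘ e.symm) (e p) 1 +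
    Complex.I • fderiv ℝ (f ∘ e.symm) (e p) Complex.I)

end Coordinates

section Connection

variable {n : ℕ} {M : Type*} [TopologicalSpace M]

/-- The `(1,0)`-part of `A^φ = (1/2) φ⁻¹ dφ` in the coordinate `e`. -/
def Az (e : OpenPartialHomeomorph M ℂ) (φ : M → UGroup n) (p : M) : Endo n :=
  (1 / 2 : ℂ) • (((φ p)⁻¹ : UGroup n) * dz e (fun q => (φ q : Endo n)) p)

/-- The `(0,1)`-part of `A^φ = (1/2) φ⁻¹ dφ` in the coordinate `e`. -/
def Azbar (e : OpenPartialHomeomorph M ℂ) (φ : M → UGroup n) (p : M) : Endo n :=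
  (1 / 2 : ℂ) • (((φ p)⁻¹ : UGroup n) * dzbar e (fun q => (φ q : Endo n)) p)

/-- The operator `D^φ_z̄ = ∂_z̄ + A^φ_z̄` on sections of the trivial bundle, in the
coordinate `e`. -/
def Dzbar (e : OpenPartialHomeomorph M ℂ) (φ : M → UGroup n) (σ : M → Vec n) (p : M) : Vec n :=
  dzbar e σ p + Azbar e φ p (σ p)

end Connection

section Bundles

variable {n : ℕ} {M : Type*} [TopologicalSpace M] [ChartedSpace ℂ M]

/-- A map `φ : M → U(n)` is harmonic: it is smooth (in the real sense) and, in every complex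
coordinate, `∂_z̄ A_z + [A_z̄, A_z] = 0`, i.e. the endomorphism `A_z` is holomorphic for the
Koszul–Malgrange structure defined by `D^φ_z̄`. -/
def IsHarmonic (φ : M → UGroup n) : Prop :=
  ContMDiff 𝓘(ℝ, ℂ) 𝓘(ℝ, Endo n) ∞ (fun p => (φ p : Endo n)) ∧
    ∀ e ∈ atlas ℂ M, ∀ p ∈ e.source,
      dzbar e (Az e φ) p + (Azbar e φ p * Az e φ p - Az e φ p * Azbar e φ p) = 0

/-- A family of subspaces of `ℂⁿ` is a smooth subbundle of the trivial bundle `M × ℂⁿ`: the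
orthogonal projection onto the fibre depends smoothly on the point. (The rank is then locally
constant.) -/
def IsSmoothSubbundle (α : M → Submodule ℂ (Vec n)) : Prop :=
  ContMDiff 𝓘(ℝ, ℂ) 𝓘(ℝ, Endo n) ∞ (fun p => (α p).starProjection)

/-- Smooth sections of `α` over `U`. -/
def smoothSections (α : M → Submodule ℂ (Vec n)) (U : Set M) : Set (M → Vec n) :=
  {σ | ContMDiffOn 𝓘(ℝ, ℂ) 𝓘(ℝ, Vec n) ∞ σ U ∧ ∀ p ∈ U, σ p ∈ α p}

/-- `α` is a uniton (flag factor) for the harmonic map `φ`: a smooth subbundle such that, over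
every coordinate domain, `D^φ_z̄` and `A^φ_z` map sections of `α` to sections of `α`. -/
structure IsUniton (φ : M → UGroup n) (α : M → Submodule ℂ (Vec n)) : Prop where
  harmonic : IsHarmonic φ
  subbundle : IsSmoothSubbundle α
  dbar_mem : ∀ e ∈ atlas ℂ M, ∀ σ ∈ smoothSections α e.source,
    Dzbar e φ σ ∈ smoothSections α e.source
  az_mem : ∀ e ∈ atlas ℂ M, ∀ σ ∈ smoothSections α e.source,
    (fun p => Az e φ p (σ p)) ∈ smoothSections α e.source

end Bundles

/-- `π_K - π_K^⊥` is unitary. -/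
theorem flag_mem_unitary {n : ℕ} (K : Submodule ℂ (Vec n)) :
    K.starProjection - Kᗮ.starProjection ∈ unitary (Endo n) := by
  have h1 : star K.starProjection = K.starProjection :=
    (isSelfAdjoint_starProjection K).star_eq
  have h2 : star Kᗮ.starProjection = Kᗮ.starProjection :=
    (isSelfAdjoint_starProjection Kᗮ).star_eq
  have hs : (K.starProjection - Kᗮ.starProjection) * (K.starProjection - Kᗮ.starProjection)
      = (1 : Endo n) := by
    have h3 : K.starProjection * K.starProjection = K.starProjection :=
      K.isIdempotentElem_starProjection
    have h4 : Kᗮ.starProjection = 1 - K.starProjection := by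
      ext1 v
      simp
    rw [h4]
    simp only [mul_sub, sub_mul, h3, mul_one, one_mul]
    abel
  rw [Unitary.mem_iff, star_sub, h1, h2]
  exact ⟨hs, hs⟩

/-- The element `π_K - π_K^⊥` of `U(n)`. -/
def flagFactor {n : ℕ} (K : Submodule ℂ (Vec n)) : UGroup n :=
  ⟨K.starProjection - Kᗮ.starProjection, flag_mem_unitary K⟩

/-- `φ_ℓ = φ₀ (π_1 - π_1^⊥) ⋯ (π_ℓ - π_ℓ^⊥)` for the constant map `φ₀` and the subbundles
`α 1, …, α ℓ` (the value `α 0` is not used). -/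
def flagProduct {n : ℕ} {M : Type*} (φ₀ : UGroup n) (α : ℕ → M → Submodule ℂ (Vec n)) :
    ℕ → M → UGroup n
  | 0 => fun _ => φ₀
  | ℓ + 1 => fun p => flagProduct φ₀ α ℓ p * flagFactor (α (ℓ + 1) p)

section Sequences

variable {n : ℕ} {M : Type*} [TopologicalSpace M]

/-- `α 1, …, α r` is a sequence of unitons starting at the constant map `φ₀`: each
`α (ℓ + 1)` is a uniton for `φ_ℓ`. -/
def IsUnitonSequence [ChartedSpace ℂ M] (φ₀ : UGroup n) (α : ℕ → M → Submodule ℂ (Vec n))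
    (r : ℕ) : Prop :=
  ∀ ℓ < r, IsUniton (flagProduct φ₀ α ℓ) (α (ℓ + 1))

/-- The covering condition `π_{ℓ-1} α_ℓ = α_{ℓ-1}` for `ℓ = 2, …, r`. The image of the bundle
`α_ℓ` under `π_{ℓ-1}` is formed by filling in holes, so equality is one of fibres off a closed
discrete set of points. -/
def IsCovering (α : ℕ → M → Submodule ℂ (Vec n)) (r : ℕ) : Prop :=
  ∀ ℓ, 2 ≤ ℓ → ℓ ≤ r → ∀ᶠ p in Filter.codiscrete M,
    (α ℓ p).map ((α (ℓ - 1) p).starProjection : Vec n →ₗ[ℂ] Vec n) = α (ℓ - 1) p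

/-- A subbundle of `M × ℂⁿ` is full if the only constant subbundle containing it is the whole
bundle. -/
def IsFull (α : M → Submodule ℂ (Vec n)) : Prop :=
  ∀ W : Submodule ℂ (Vec n), (∀ p, α p ≤ W) → W = ⊤

/-- `φ` has (minimal) uniton number `r`: `r` is the least number of unitons in a factorization
`φ = φ₀ (π_1 - π_1^⊥) ⋯ (π_r - π_r^⊥)` with `φ₀` constant. -/
def HasUnitonNumber [ChartedSpace ℂ M] (φ : M → UGroup n) (r : ℕ) : Prop :=
  IsLeast {k : ℕ | ∃ (φ₀ : UGroup n) (α : ℕ → M → Submodule ℂ (Vec n)),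
    IsUnitonSequence φ₀ α k ∧ φ = flagProduct φ₀ α k} r

end Sequences

end

end UnitonTheory

/-! Attach to the factorization the extended solution `Φ_l = φ₀ ∏ (π_ℓ + l π_ℓ^⊥)`, with value `φ_i`
at `l = -1`, and the reversed product `G_l` of the factors `l π_ℓ + π_ℓ^⊥`, so that `Φ_l G_l = l ^
i`. The uniton equations give `Φ_l⁻¹ ∂_z Φ_l = (1 - l⁻¹) A_z` and `Φ_l⁻¹ ∂_z̄ Φ_l = (1 - l) A_z̄`,
where `A` depends only on `φ_i` (`hasWirtinger_extendedSolution`). If `S_l` is the extended solution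
of another factorization with `k` factors, then `P(l) = S_l G_l` is therefore constant on `M` for `l
≠ 0`, and `P(l) Φ_l = l ^ i S_l` at every point.

The covering condition makes the range of `Φ_0` equal to `φ₀ α_1` off a discrete set, so by fullness
`R Φ_0 = 0` on `M` forces `R = 0`. Removing one factor `l` at a time then gives `P(l) = l ^ i Q(l)`
with `Q` entire (`exists_eq_pow_smul`). Multiplying on the left by the reversed product `T_l` of
`S_l`, for which `T_l S_l = l ^ k`, yields `G_l = l ^ (i - k) T_l Q(l)` when `k < i`, hence `G_0 =
0` at the base point. The covering condition and the properness of `α_i` provide a base point where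
`G_0 ≠ 0`, a contradiction. -/

namespace UnitonTheory

noncomputable section

/-! ### Calculus of the Wirtinger derivatives in a chart. -/

section Wirtinger

variable {M : Type*} [TopologicalSpace M]

/-- `f` is real differentiable at `p` in the coordinate `e`, with `∂f/∂z = a`, `∂f/∂z̄ = b`. -/
structure HasWirtinger {F : Type*} [NormedAddCommGroup F] [NormedSpace ℝ F] [NormedSpace ℂ F]
    (e : OpenPartialHomeomorph M ℂ) (f : M → F) (p : M) (a b : F) : Prop where
  diff : DifferentiableAt ℝ (f ∘ e.symm) (e p)
  dz_eq : dz e f p = a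
  dzbar_eq : dzbar e f p = b

section Linear

variable {F : Type*} [NormedAddCommGroup F] [NormedSpace ℝ F] [NormedSpace ℂ F]
  {G : Type*} [NormedAddCommGroup G] [NormedSpace ℝ G] [NormedSpace ℂ G]
  {e : OpenPartialHomeomorph M ℂ} {f g : M → F} {p : M} {a b a' b' : F}

theorem HasWirtinger.add (hf : HasWirtinger e f p a b) (hg : HasWirtinger e g p a' b') :
    HasWirtinger e (fun q => f q + g q) p (a + a') (b + b') := by
  have h : fderiv ℝ ((fun q => f q + g q) ∘ e.symm) (e p)
      = fderiv ℝ (f ∘ e.symm) (e p) + fderiv ℝ (g ∘ e.symm) (e p) := fderiv_add hf.diff hg.diff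
  refine ⟨hf.diff.add hg.diff, ?_, ?_⟩
  · rw [← hf.dz_eq, ← hg.dz_eq]
    simp only [dz, h, add_apply]
    module
  · rw [← hf.dzbar_eq, ← hg.dzbar_eq]
    simp only [dzbar, h, add_apply]
    module

theorem hasWirtinger_const (e : OpenPartialHomeomorph M ℂ) (c : F) (p : M) :
    HasWirtinger e (fun _ => c) p 0 0 := by
  have h : (fun _ : M => c) ∘ e.symm = fun _ => c := rfl
  refine ⟨?_, ?_, ?_⟩
  · rw [h]; exact differentiableAt_const c
  · simp [dz, h]
  · simp [dzbar, h]

theorem HasWirtinger.const_smul [SMulCommClass ℝ ℂ F] (c : ℂ) (hf : HasWirtinger e f p a b) :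
    HasWirtinger e (fun q => c • f q) p (c • a) (c • b) := by
  have h : fderiv ℝ ((fun q => c • f q) ∘ e.symm) (e p)
      = c • fderiv ℝ (f ∘ e.symm) (e p) := (hf.diff.hasFDerivAt.const_smul c).fderiv
  refine ⟨hf.diff.const_smul c, ?_, ?_⟩
  · rw [← hf.dz_eq]
    simp only [dz, h, smul_apply]
    module
  · rw [← hf.dzbar_eq]
    simp only [dzbar, h, smul_apply]
    module

/-- Composition with a real linear map which is complex linear. -/
theorem HasWirtinger.linear (hf : HasWirtinger e f p a b) (L : F →L[ℝ] G)
    (hL : ∀ (c : ℂ) x, L (c • x) = c • L x) :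
    HasWirtinger e (fun q => L (f q)) p (L a) (L b) := by
  have h : fderiv ℝ ((fun q => L (f q)) ∘ e.symm) (e p)
      = L.comp (fderiv ℝ (f ∘ e.symm) (e p)) := (L.hasFDerivAt.comp _ hf.diff.hasFDerivAt).fderiv
  refine ⟨L.differentiableAt.comp _ hf.diff, ?_, ?_⟩
  · rw [← hf.dz_eq]
    simp only [dz, h, ContinuousLinearMap.comp_apply, hL, map_sub]
  · rw [← hf.dzbar_eq]
    simp only [dzbar, h, ContinuousLinearMap.comp_apply, hL, map_add]

/-- Composition with a real linear map which is complex antilinear. -/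
theorem HasWirtinger.antilinear (hf : HasWirtinger e f p a b) (L : F →L[ℝ] G)
    (hL : ∀ (c : ℂ) x, L (c • x) = starRingEnd ℂ c • L x) :
    HasWirtinger e (fun q => L (f q)) p (L b) (L a) := by
  have h : fderiv ℝ ((fun q => L (f q)) ∘ e.symm) (e p)
      = L.comp (fderiv ℝ (f ∘ e.symm) (e p)) := (L.hasFDerivAt.comp _ hf.diff.hasFDerivAt).fderiv
  refine ⟨L.differentiableAt.comp _ hf.diff, ?_, ?_⟩
  · rw [← hf.dzbar_eq]
    simp [dz, dzbar, h, hL, sub_eq_add_neg, map_ofNat]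
  · rw [← hf.dz_eq]
    simp [dz, dzbar, h, hL, sub_eq_add_neg, map_ofNat]

theorem HasWirtinger.congr_deriv (hf : HasWirtinger e f p a b) (ha : a = a') (hb : b = b') :
    HasWirtinger e f p a' b' := ha ▸ hb ▸ hf

theorem hasWirtinger_of_differentiableAt (h : DifferentiableAt ℝ (f ∘ e.symm) (e p)) :
    HasWirtinger e f p (dz e f p) (dzbar e f p) := ⟨h, rfl, rfl⟩

theorem HasWirtinger.fderiv_eq_zero (hf : HasWirtinger e f p 0 0) :
    fderiv ℝ (f ∘ e.symm) (e p) = 0 := by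
  have h1 := hf.dz_eq
  have h2 := hf.dzbar_eq
  simp only [dz, dzbar] at h1 h2
  set D := fderiv ℝ (f ∘ e.symm) (e p)
  have h3 : D 1 = 0 := by
    have : D 1 = (1 / 2 : ℂ) • (D 1 - Complex.I • D Complex.I)
      + (1 / 2 : ℂ) • (D 1 + Complex.I • D Complex.I) := by module
    rw [this, h1, h2, add_zero]
  have h4 : D Complex.I = 0 := by
    have : Complex.I • D Complex.I = (1 / 2 : ℂ) • (D 1 + Complex.I • D Complex.I)
      - (1 / 2 : ℂ) • (D 1 - Complex.I • D Complex.I) := by module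
    rw [h1, h2, sub_zero] at this
    exact (smul_eq_zero.1 this).resolve_left Complex.I_ne_zero
  ext x
  have hx : x = x.re • (1 : ℂ) + x.im • Complex.I := by simp
  rw [hx, map_add, map_smul, map_smul, h3, h4]
  simp

end Linear

end Wirtinger

/-! ### Gauge identities for a single uniton factor. -/

section Dressing

variable {R : Type*} [Ring R] [Algebra ℂ R] {P A d : R} {l m : ℂ}

/-- With `g = P + l P^⊥`, whose inverse is `P + m P^⊥`, this computes the `z`-part of the gauge
transform `g⁻¹ (X g + ∂g)` of `X = (1 - m) A`. The uniton equations make the result again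
proportional to `1 - m`; `dressing_dzbar` is the `z̄`-part. -/
theorem dressing_dz (hAP : A * P = P * (A * P))
    (hd : P * d = P * A - A * P) (hlm : l * m = 1) :
    (m • (1 : R) + (1 - m) • P) * (((1 - m) • A) * (l • (1 : R) + (1 - l) • P) + (1 - l) • d)
      = (1 - m) • (A - d) := by
  simp only [mul_add, add_mul, smul_mul_assoc, mul_smul_comm, one_mul, mul_one, hd, ← hAP]
  match_scalars
  · linear_combination (1 - m) * hlm
  · linear_combination (m - 1) * hlm
  · linear_combination
  · linear_combination -hlm

theorem dressing_dzbar (hPA : P * A = P * (A * P))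
    (hd : d * P = P * A - A * P) (hdP : d = d * P + P * d) (hlm : l * m = 1) :
    (m • (1 : R) + (1 - m) • P) * (((1 - l) • A) * (l • (1 : R) + (1 - l) • P) + (1 - l) • d)
      = (1 - l) • (A + d) := by
  have hPd : P * d = d - P * A + A * P := by
    rw [← add_sub_cancel_left (d * P) (P * d), ← hdP, hd]; abel
  simp only [mul_add, add_mul, smul_mul_assoc, mul_smul_comm, one_mul, mul_one, hPd, ← hPA]
  match_scalars
  · linear_combination (1 - l) * hlm
  · linear_combination
  · linear_combination -(1 - l) * hlm
  · linear_combination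

end Dressing

/-! ### Derivatives of endomorphism-valued and unitary maps. -/

section Endomorphisms

variable {M : Type*} [TopologicalSpace M] {n : ℕ} {e : OpenPartialHomeomorph M ℂ} {p : M}

/-- The adjoint, as a real linear map. -/
def starReal (n : ℕ) : Endo n →L[ℝ] Endo n where
  toFun T := star T
  map_add' := fun S T => star_add S T
  map_smul' r T := by
    have h (S : Endo n) : r • S = (r : ℂ) • S := by ext v i; simp
    rw [RingHom.id_apply, h, h, star_smul]; simp
  cont := (ContinuousLinearMap.adjoint (𝕜 := ℂ) (E := Vec n) (F := Vec n)).continuous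

/-- Evaluation at a vector, as a real linear map. -/
def evalReal {n : ℕ} (v : Vec n) : Endo n →L[ℝ] Vec n where
  toFun T := T v
  map_add' _ _ := rfl
  map_smul' _ _ := rfl
  cont := by fun_prop

theorem HasWirtinger.mul {f g : M → Endo n} {a b a' b' : Endo n} (hp : p ∈ e.source)
    (hf : HasWirtinger e f p a b) (hg : HasWirtinger e g p a' b') :
    HasWirtinger e (fun q => f q * g q) p (f p * a' + a * g p) (f p * b' + b * g p) := by
  have hd : HasFDerivAt ((fun q => f q * g q) ∘ e.symm) _ (e p) :=
    (ContinuousLinearMap.mul ℝ (Endo n)).hasFDerivAt_of_bilinear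
      hf.diff.hasFDerivAt hg.diff.hasFDerivAt
  have h (v : ℂ) : fderiv ℝ ((fun q => f q * g q) ∘ e.symm) (e p) v
      = f p * fderiv ℝ (g ∘ e.symm) (e p) v + fderiv ℝ (f ∘ e.symm) (e p) v * g p := by
    rw [hd.fderiv]
    simp [e.left_inv hp]
  refine ⟨hd.differentiableAt, ?_, ?_⟩
  · rw [← hf.dz_eq, ← hg.dz_eq]
    simp only [dz, h, mul_smul_comm, smul_mul_assoc, mul_sub, sub_mul]
    module
  · rw [← hf.dzbar_eq, ← hg.dzbar_eq]
    simp only [dzbar, h, mul_smul_comm, smul_mul_assoc, mul_add, add_mul]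
    module

theorem HasWirtinger.star {f : M → Endo n} {a b : Endo n} (hf : HasWirtinger e f p a b) :
    HasWirtinger e (fun q => Star.star (f q)) p (Star.star b) (Star.star a) :=
  hf.antilinear (starReal n) fun c x => star_smul c x

theorem HasWirtinger.apply {f : M → Endo n} {a b : Endo n} (hf : HasWirtinger e f p a b)
    (v : Vec n) : HasWirtinger e (fun q => f q v) p (a v) (b v) :=
  hf.linear (evalReal v) fun _ _ => rfl

theorem HasWirtinger.Az_eq {φ : M → UGroup n} {a b : Endo n}
    (hf : HasWirtinger e (fun q => (φ q : Endo n)) p a b) :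
    Az e φ p = (1 / 2 : ℂ) • (Star.star (φ p : Endo n) * a) := by
  rw [← hf.dz_eq]; rfl

theorem HasWirtinger.Azbar_eq {φ : M → UGroup n} {a b : Endo n}
    (hf : HasWirtinger e (fun q => (φ q : Endo n)) p a b) :
    Azbar e φ p = (1 / 2 : ℂ) • (Star.star (φ p : Endo n) * b) := by
  rw [← hf.dzbar_eq]; rfl

/-- Differentiate `φ* φ = 1`; the adjoint exchanges the two Wirtinger derivatives. -/
theorem HasWirtinger.star_Az {φ : M → UGroup n} {a b : Endo n} (hp : p ∈ e.source)
    (hf : HasWirtinger e (fun q => (φ q : Endo n)) p a b) :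
    Star.star (Az e φ p) = -Azbar e φ p := by
  have h := hf.star.mul hp hf
  simp only [Unitary.coe_star_mul_self] at h
  have h2 := h.dzbar_eq.symm.trans (hasWirtinger_const e _ p).dzbar_eq
  have h3 : Star.star a * (φ p : Endo n) = -(Star.star (φ p : Endo n) * b) :=
    eq_neg_of_add_eq_zero_right h2
  rw [hf.Az_eq, hf.Azbar_eq, star_smul, star_mul, star_star, h3]
  simp

end Endomorphisms

/-! ### Real smoothness, density and local constancy on the surface. -/

section Charts

variable {M : Type*} [TopologicalSpace M] [ChartedSpace ℂ M]

theorem isManifold_real [IsManifold 𝓘(ℂ) ω M] : IsManifold 𝓘(ℝ, ℂ) ∞ M := by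
  refine isManifold_of_contDiffOn _ _ _ fun e e' he he' => ?_
  have h := contMDiffOn_iff_contDiffOn.1
    (contMDiffOn_of_mem_contDiffGroupoid
      (HasGroupoid.compatible (G := contDiffGroupoid ω 𝓘(ℂ)) he he'))
  simpa using (h.restrict_scalars ℝ).of_le le_top

theorem differentiableAt_comp_symm [IsManifold 𝓘(ℝ, ℂ) ∞ M] {F : Type*} [NormedAddCommGroup F]
    [NormedSpace ℝ F] {e : OpenPartialHomeomorph M ℂ} (he : e ∈ atlas ℂ M) {f : M → F}
    (hf : ContMDiff 𝓘(ℝ, ℂ) 𝓘(ℝ, F) ∞ f) {p : M} (hp : p ∈ e.source) :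
    DifferentiableAt ℝ (f ∘ e.symm) (e p) := by
  have h1 := contMDiffOn_symm_of_mem_maximalAtlas (I := 𝓘(ℝ, ℂ)) (n := ∞)
    (IsManifold.subset_maximalAtlas he)
  have h2 := contMDiffOn_iff_contDiffOn.1 (hf.comp_contMDiffOn h1)
  exact (h2.contDiffAt (e.open_target.mem_nhds (e.map_source hp))).differentiableAt (by simp)

/-- A surface has no isolated points: a chart would carry one to an isolated point of `ℂ`. -/
theorem dense_of_mem_codiscrete {s : Set M} (hs : s ∈ Filter.codiscrete M) : Dense s := by
  intro x
  have hx : (nhdsWithin x {x}ᶜ).NeBot := by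
    rw [Filter.neBot_iff, Ne, ← isOpen_singleton_iff_punctured_nhds]
    intro h
    have h2 := (chartAt ℂ x).isOpen_image_of_subset_source h
      (by simp)
    rw [Set.image_singleton, isOpen_singleton_iff_punctured_nhds] at h2
    exact (inferInstance : (nhdsWithin (chartAt ℂ x x) {chartAt ℂ x x}ᶜ).NeBot).ne h2
  have h := mem_codiscrete.1 hs x
  rw [Filter.disjoint_principal_right, compl_compl] at h
  exact mem_closure_iff_nhdsWithin_neBot.2 (hx.mono (by
    rw [nhdsWithin]; exact le_inf (nhdsWithin_le_nhds) (Filter.le_principal_iff.2 h)))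

theorem eq_of_fderiv_eq_zero [ConnectedSpace M] {F : Type*} [NormedAddCommGroup F]
    [NormedSpace ℝ F] {f : M → F}
    (hd : ∀ e ∈ atlas ℂ M, ∀ p ∈ e.source, DifferentiableAt ℝ (f ∘ e.symm) (e p))
    (h0 : ∀ e ∈ atlas ℂ M, ∀ p ∈ e.source, fderiv ℝ (f ∘ e.symm) (e p) = 0) (p q : M) :
    f p = f q := by
  refine IsLocallyConstant.apply_eq_of_preconnectedSpace ?_ p q
  rw [IsLocallyConstant.iff_eventually_eq]
  intro x
  set e := chartAt ℂ x
  have he : e ∈ atlas ℂ M := chart_mem_atlas ℂ x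
  have hx : x ∈ e.source := mem_chart_source ℂ x
  obtain ⟨r, hr, hball⟩ := Metric.isOpen_iff.1 e.open_target (e x) (e.map_source hx)
  have hpt : ∀ z ∈ Metric.ball (e x) r, e.symm z ∈ e.source ∧ e (e.symm z) = z := fun z hz =>
    ⟨e.map_target (hball hz), e.right_inv (hball hz)⟩
  have hU : e.source ∩ e ⁻¹' Metric.ball (e x) r ∈ nhds x :=
    (e.isOpen_inter_preimage Metric.isOpen_ball).mem_nhds ⟨hx, Metric.mem_ball_self hr⟩
  filter_upwards [hU] with y hy
  have h := Metric.isOpen_ball.is_const_of_fderiv_eq_zero (𝕜 := ℝ) (f := f ∘ e.symm)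
    (convex_ball (e x) r).isPreconnected
    (fun z hz => by
      obtain ⟨h1, h2⟩ := hpt z hz
      have := hd e he _ h1
      rw [h2] at this
      exact this.differentiableWithinAt)
    (fun z hz => by
      obtain ⟨h1, h2⟩ := hpt z hz
      have := h0 e he _ h1
      rw [h2] at this
      exact this) hy.2 (Metric.mem_ball_self hr)
  simpa [e.left_inv hy.1, e.left_inv hx] using h

end Charts

/-! ### The uniton equations as identities of endomorphisms. -/

section Unitons

variable {n : ℕ} {M : Type*} [TopologicalSpace M] [ChartedSpace ℂ M]

/-- Since `A' = -A*`, the adjoint of "`A` preserves the range of `P`" says that `A'` preserves its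
kernel. Combined with the `z̄`-condition and the derivative of `P² = P`, this determines `d' P`;
taking adjoints determines `P d`. -/
theorem uniton_algebra {R : Type*} [Ring R] [StarRing R] {P A A' d d' : R} (hP : star P = P)
    (hA : A * P = P * (A * P)) (hdA : d' + A' * P = P * (d' + A' * P)) (hd : star d' = d)
    (hstar : star A = -A') (hdP : d' = P * d' + d' * P) :
    P * A' = P * (A' * P) ∧ P * d = P * A - A * P ∧ d' * P = P * A' - A' * P ∧
      d' = d' * P + P * d' := by
  have hA' : star A' = -A := by rw [← star_star A, hstar, star_neg, neg_neg]
  have hPA : P * A' = P * (A' * P) := by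
    have h1 := congrArg star hA
    simp only [star_mul, hP, hstar] at h1
    simpa [mul_assoc] using h1
  have hd' : d' * P = P * A' - A' * P := by
    have h1 : d' + A' * P = P * d' + P * A' := by rw [hdA, mul_add, ← hPA]
    have h2 : d' * P = d' - P * d' := eq_sub_of_add_eq' hdP.symm
    rw [h2, sub_eq_sub_iff_add_eq_add, h1, add_comm]
  refine ⟨hPA, ?_, hd', hdP.trans (add_comm _ _)⟩
  have h1 := congrArg star hd'
  simp only [star_mul, star_sub, hP, hA', hd] at h1
  rw [h1]
  noncomm_ring

/-- The pointwise algebraic form of the uniton equations. -/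
theorem IsUniton.pointwise [IsManifold 𝓘(ℝ, ℂ) ∞ M] {φ : M → UGroup n}
    {α : M → Submodule ℂ (Vec n)} (h : IsUniton φ α) {e : OpenPartialHomeomorph M ℂ}
    (he : e ∈ atlas ℂ M) {p : M} (hp : p ∈ e.source) :
    ∃ d d' : Endo n, HasWirtinger e (fun q => (α q).starProjection) p d d' ∧
      Az e φ p * (α p).starProjection
        = (α p).starProjection * (Az e φ p * (α p).starProjection) ∧
      (α p).starProjection * Azbar e φ p
        = (α p).starProjection * (Azbar e φ p * (α p).starProjection) ∧
      (α p).starProjection * d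
        = (α p).starProjection * Az e φ p - Az e φ p * (α p).starProjection ∧
      d' * (α p).starProjection
        = (α p).starProjection * Azbar e φ p - Azbar e φ p * (α p).starProjection ∧
      d' = d' * (α p).starProjection + (α p).starProjection * d' := by
  have hπ : HasWirtinger e (fun q => (α q).starProjection) p _ _ :=
    hasWirtinger_of_differentiableAt (differentiableAt_comp_symm he h.subbundle hp)
  set d := dz e (fun q => (α q).starProjection) p
  set d' := dzbar e (fun q => (α q).starProjection) p
  have hφ : HasWirtinger e (fun q => (φ q : Endo n)) p _ _ :=
    hasWirtinger_of_differentiableAt (differentiableAt_comp_symm he h.harmonic.1 hp)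
  -- Projections of constant vectors fill each fibre, so testing on them turns the conditions on
  -- sections into operator identities.
  have hsec (v : Vec n) : (fun q => (α q).starProjection v) ∈ smoothSections α e.source :=
    ⟨((evalReal v).contMDiff.comp h.subbundle).contMDiffOn,
      fun q _ => Submodule.starProjection_apply_mem _ _⟩
  have hstar : star (Az e φ p) = -Azbar e φ p := hφ.star_Az hp
  set A := Az e φ p
  set A' := Azbar e φ p
  set P := (α p).starProjection with hP
  have hPs : star P = P := (isSelfAdjoint_starProjection (α p)).star_eq
  have hfix (v : Vec n) (hv : v ∈ α p) : P v = v := Submodule.starProjection_eq_self_iff.2 hv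
  have hA : A * P = P * (A * P) := by
    ext1 v
    exact (hfix _ ((h.az_mem e he _ (hsec v)).2 p hp)).symm
  have hdA : d' + A' * P = P * (d' + A' * P) := by
    ext1 v
    have h1 := hfix _ ((h.dbar_mem e he _ (hsec v)).2 p hp)
    rw [Dzbar, (hπ.apply v).dzbar_eq] at h1
    exact h1.symm
  have hds : star d' = d := by
    have h1 := hπ.star.dz_eq
    simp only [(isSelfAdjoint_starProjection _).star_eq] at h1
    exact h1.symm
  have hdP : d' = P * d' + d' * P := by
    have h1 := (hπ.mul hp hπ).dzbar_eq
    have h2 : (fun q => (α q).starProjection * (α q).starProjection)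
        = fun q => (α q).starProjection :=
      funext fun q => (α q).isIdempotentElem_starProjection
    rw [h2, hπ.dzbar_eq] at h1
    exact h1
  obtain ⟨h1, h2, h3, h4⟩ := uniton_algebra hPs hA hdA hds hstar hdP
  exact ⟨d, d', hπ, hA, h1, h2, h3, h4⟩

end Unitons

/-! ### Extended solutions and their dependence on the point. -/

section Extended

variable {n : ℕ} {M : Type*}

/-- The extended solution `φ₀ (π_1 + l π_1^⊥) ⋯ (π_ℓ + l π_ℓ^⊥)` with loop parameter `l`. -/
def extendedSolution (φ₀ : UGroup n) (α : ℕ → M → Submodule ℂ (Vec n)) (l : ℂ) : ℕ → M → Endo n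
  | 0 => fun _ => (φ₀ : Endo n)
  | ℓ + 1 => fun p => extendedSolution φ₀ α l ℓ p *
      (l • (1 : Endo n) + (1 - l) • (α (ℓ + 1) p).starProjection)

/-- The reversed product `(a π_ℓ + b π_ℓ^⊥) ⋯ (a π_1 + b π_1^⊥) φ₀⁻¹`. -/
def reversedProduct (φ₀ : UGroup n) (α : ℕ → M → Submodule ℂ (Vec n)) (a b : ℂ) : ℕ → M → Endo n
  | 0 => fun _ => star (φ₀ : Endo n)
  | ℓ + 1 => fun p => (b • (1 : Endo n) + (a - b) • (α (ℓ + 1) p).starProjection) *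
      reversedProduct φ₀ α a b ℓ p

/-- The factors are `P + l P^⊥` and `a P + b P^⊥`. The choice `a = 1`, `b = l⁻¹` gives the inverse;
`a = l`, `b = 1` clears the denominator and stays polynomial in `l`. -/
theorem factor_mul_factor {R : Type*} [Ring R] [Algebra ℂ R] {P : R} {l a b : ℂ} (hP : P * P = P)
    (h : a = l * b) :
    (l • (1 : R) + (1 - l) • P) * (b • (1 : R) + (a - b) • P) = a • (1 : R) ∧
    (b • (1 : R) + (a - b) • P) * (l • (1 : R) + (1 - l) • P) = a • (1 : R) := by
  subst h
  constructor
  all_goals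
    simp only [mul_add, add_mul, smul_mul_assoc, mul_smul_comm, one_mul, mul_one, hP]
    match_scalars <;> ring

theorem mul_mul_eq_pow_succ {R : Type*} [Ring R] [Algebra ℂ R] {F G x y : R} {a : ℂ} {k : ℕ}
    (hxy : x * y = a • (1 : R)) (h : F * G = a ^ k • (1 : R)) :
    (F * x) * (y * G) = a ^ (k + 1) • (1 : R) := by
  rw [mul_assoc, ← mul_assoc x, hxy, smul_mul_assoc, one_mul, mul_smul_comm, h, smul_smul, pow_succ']

theorem mul_mul_eq_pow_succ' {R : Type*} [Ring R] [Algebra ℂ R] {F G x y : R} {a : ℂ} {k : ℕ}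
    (hxy : y * x = a • (1 : R)) (h : G * F = a ^ k • (1 : R)) :
    (y * G) * (F * x) = a ^ (k + 1) • (1 : R) := by
  rw [mul_assoc, ← mul_assoc G, h, smul_mul_assoc, one_mul, mul_smul_comm, hxy, smul_smul, pow_succ]

theorem extendedSolution_mul_reversedProduct (φ₀ : UGroup n) (α : ℕ → M → Submodule ℂ (Vec n))
    {l a b : ℂ} (h : a = l * b) (ℓ : ℕ) (p : M) :
    extendedSolution φ₀ α l ℓ p * reversedProduct φ₀ α a b ℓ p = a ^ ℓ • (1 : Endo n) := by
  induction ℓ with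
  | zero => rw [pow_zero, one_smul]; exact Unitary.coe_mul_star_self φ₀
  | succ ℓ ih =>
    exact mul_mul_eq_pow_succ
      (factor_mul_factor (α (ℓ + 1) p).isIdempotentElem_starProjection h).1 ih

theorem reversedProduct_mul_extendedSolution (φ₀ : UGroup n) (α : ℕ → M → Submodule ℂ (Vec n))
    {l a b : ℂ} (h : a = l * b) (ℓ : ℕ) (p : M) :
    reversedProduct φ₀ α a b ℓ p * extendedSolution φ₀ α l ℓ p = a ^ ℓ • (1 : Endo n) := by
  induction ℓ with
  | zero => rw [pow_zero, one_smul]; exact Unitary.coe_star_mul_self φ₀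
  | succ ℓ ih =>
    exact mul_mul_eq_pow_succ'
      (factor_mul_factor (α (ℓ + 1) p).isIdempotentElem_starProjection h).2 ih

theorem extendedSolution_neg_one (φ₀ : UGroup n) (α : ℕ → M → Submodule ℂ (Vec n)) (ℓ : ℕ)
    (p : M) : extendedSolution φ₀ α (-1) ℓ p = (flagProduct φ₀ α ℓ p : Endo n) := by
  induction ℓ with
  | zero => rfl
  | succ ℓ ih =>
    have h : (-1 : ℂ) • (1 : Endo n) + (1 - (-1 : ℂ)) • (α (ℓ + 1) p).starProjection
        = (flagFactor (α (ℓ + 1) p) : Endo n) := by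
      ext1 v
      simp only [flagFactor, Submodule.starProjection_orthogonal_val, add_apply, smul_apply,
        sub_apply, one_apply_eq_self]
      module
    exact congrArg₂ (· * ·) ih h

theorem differentiable_extendedSolution (φ₀ : UGroup n) (α : ℕ → M → Submodule ℂ (Vec n)) (ℓ : ℕ)
    (p : M) : Differentiable ℂ fun l => extendedSolution φ₀ α l ℓ p := by
  induction ℓ with
  | zero => exact differentiable_const _
  | succ ℓ ih =>
    refine ih.mul (.add ?_ ?_)
    · exact differentiable_id.smul_const _
    · exact (differentiable_id.const_sub 1).smul_const _

theorem differentiable_reversedProduct (φ₀ : UGroup n) (α : ℕ → M → Submodule ℂ (Vec n)) (ℓ : ℕ)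
    (p : M) : Differentiable ℂ fun l => reversedProduct φ₀ α l 1 ℓ p := by
  induction ℓ with
  | zero => exact differentiable_const _
  | succ ℓ ih =>
    refine Differentiable.mul (.add ?_ ?_) ih
    · exact differentiable_const _
    · exact (differentiable_id.sub_const 1).smul_const _

theorem dressing_derivative {R : Type*} [Ring R] {F X g g' D Y : R} (hg : g * g' = 1)
    (h : g' * (X * g + D) = Y) : F * D + (F * X) * g = (F * g) * Y := by
  rw [← h, mul_assoc F g, ← mul_assoc g, hg]
  noncomm_ring

variable [TopologicalSpace M] [ChartedSpace ℂ M]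

/-- Each new factor acts by a gauge transformation that replaces `A_z` by `A_z - d` and `A_z̄` by
`A_z̄ + d'`, uniformly in `l`. -/
theorem hasWirtinger_extendedSolution [IsManifold 𝓘(ℝ, ℂ) ∞ M] {φ₀ : UGroup n}
    {α : ℕ → M → Submodule ℂ (Vec n)} {r : ℕ} (hα : IsUnitonSequence φ₀ α r)
    {e : OpenPartialHomeomorph M ℂ} (he : e ∈ atlas ℂ M) {p : M} (hp : p ∈ e.source)
    {ℓ : ℕ} (hℓ : ℓ ≤ r) {l m : ℂ} (hlm : l * m = 1) :
    HasWirtinger e (extendedSolution φ₀ α l ℓ) p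
      (extendedSolution φ₀ α l ℓ p * ((1 - m) • Az e (flagProduct φ₀ α ℓ) p))
      (extendedSolution φ₀ α l ℓ p * ((1 - l) • Azbar e (flagProduct φ₀ α ℓ) p)) := by
  induction ℓ generalizing l m with
  | zero =>
    have h : HasWirtinger e (fun q => (flagProduct φ₀ α 0 q : Endo n)) p 0 0 :=
      hasWirtinger_const e (φ₀ : Endo n) p
    rw [h.Az_eq, h.Azbar_eq]
    exact (hasWirtinger_const e (φ₀ : Endo n) p).congr_deriv (by simp) (by simp)
  | succ ℓ ih =>
    obtain ⟨d, d', hπ, h1, h2, h3, h4, h5⟩ := (hα ℓ hℓ).pointwise he hp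
    have hPP := (α (ℓ + 1) p).isIdempotentElem_starProjection
    have step {l m : ℂ} (hlm : l * m = 1) :
        HasWirtinger e (extendedSolution φ₀ α l (ℓ + 1)) p
          (extendedSolution φ₀ α l (ℓ + 1) p * ((1 - m) • (Az e (flagProduct φ₀ α ℓ) p - d)))
          (extendedSolution φ₀ α l (ℓ + 1) p *
            ((1 - l) • (Azbar e (flagProduct φ₀ α ℓ) p + d'))) := by
      have hg := (hasWirtinger_const e (l • (1 : Endo n)) p).add (hπ.const_smul (1 - l))
      have hF := (ih (Nat.le_of_succ_le hℓ) hlm).mul hp hg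
      have hgg : (l • (1 : Endo n) + (1 - l) • (α (ℓ + 1) p).starProjection) *
          (m • (1 : Endo n) + (1 - m) • (α (ℓ + 1) p).starProjection) = 1 := by
        rw [(factor_mul_factor hPP hlm.symm).1, one_smul]
      refine hF.congr_deriv ?_ ?_
      · rw [zero_add]
        exact dressing_derivative hgg (dressing_dz h1 h3 hlm)
      · rw [zero_add]
        exact dressing_derivative hgg (dressing_dzbar h2 h4 h5 hlm)
    -- At `l = -1` the extended solution is `φ_{ℓ+1}` itself, so this instance identifies the
    -- transformed coefficients with those of `φ_{ℓ+1}`.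
    have hneg := step (l := -1) (m := -1) (by norm_num)
    rw [funext (extendedSolution_neg_one φ₀ α (ℓ + 1))] at hneg
    have hAz : Az e (flagProduct φ₀ α (ℓ + 1)) p = Az e (flagProduct φ₀ α ℓ) p - d := by
      rw [hneg.Az_eq, ← mul_assoc, Unitary.coe_star_mul_self, one_mul]
      module
    have hAzbar : Azbar e (flagProduct φ₀ α (ℓ + 1)) p = Azbar e (flagProduct φ₀ α ℓ) p + d' := by
      rw [hneg.Azbar_eq, ← mul_assoc, Unitary.coe_star_mul_self, one_mul]
      module
    rw [hAz, hAzbar]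
    exact step hlm

theorem exists_hasWirtinger_reversedProduct [IsManifold 𝓘(ℝ, ℂ) ∞ M] {φ₀ : UGroup n}
    {α : ℕ → M → Submodule ℂ (Vec n)} {r : ℕ} (hα : IsUnitonSequence φ₀ α r)
    {e : OpenPartialHomeomorph M ℂ} (he : e ∈ atlas ℂ M) {p : M} (hp : p ∈ e.source)
    {ℓ : ℕ} (hℓ : ℓ ≤ r) (a b : ℂ) :
    ∃ c d, HasWirtinger e (reversedProduct φ₀ α a b ℓ) p c d := by
  induction ℓ with
  | zero => exact ⟨_, _, hasWirtinger_const e _ p⟩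
  | succ ℓ ih =>
    obtain ⟨c, d, h⟩ := ih (Nat.le_of_succ_le hℓ)
    have hπ : HasWirtinger e (fun q => (α (ℓ + 1) q).starProjection) p _ _ :=
      hasWirtinger_of_differentiableAt (differentiableAt_comp_symm he (hα ℓ hℓ).subbundle hp)
    exact ⟨_, _, ((hasWirtinger_const e (b • (1 : Endo n)) p).add
      (hπ.const_smul (a - b))).mul hp h⟩

/-- Here `∂F = F X`, `∂S = S X` and `∂G = Y`. Constancy of `F G` gives `Y = -X G`, which also kills
the derivative of `S G`. -/
theorem mul_add_mul_eq_zero {R : Type*} [Ring R] [Algebra ℂ R] {F G X Y S : R} {a : ℂ}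
    (ha : a ≠ 0) (hGF : G * F = a • (1 : R)) (h : F * Y + (F * X) * G = 0) :
    S * Y + (S * X) * G = 0 := by
  have h1 : a • (Y + X * G) = 0 := by
    have : G * (F * Y + (F * X) * G) = (G * F) * (Y + X * G) := by noncomm_ring
    rw [h, mul_zero, hGF, smul_mul_assoc, one_mul] at this
    exact this.symm
  have h2 : Y + X * G = 0 := by
    rw [← one_smul ℂ (Y + X * G), ← inv_mul_cancel₀ ha, mul_smul, h1, smul_zero]
  rw [mul_assoc, ← mul_add, h2, mul_zero]

/-- Two extended solutions of the same map differ by a left factor that does not depend on the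
point. -/
theorem extendedSolution_mul_reversedProduct_const [IsManifold 𝓘(ℝ, ℂ) ∞ M] [ConnectedSpace M]
    {φ₀ ψ₀ : UGroup n} {α β : ℕ → M → Submodule ℂ (Vec n)} {i k : ℕ}
    (hα : IsUnitonSequence φ₀ α i) (hβ : IsUnitonSequence ψ₀ β k)
    (h : flagProduct φ₀ α i = flagProduct ψ₀ β k) {l : ℂ} (hl : l ≠ 0) (p q : M) :
    extendedSolution ψ₀ β l k p * reversedProduct φ₀ α l 1 i p
      = extendedSolution ψ₀ β l k q * reversedProduct φ₀ α l 1 i q := by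
  have key : ∀ e ∈ atlas ℂ M, ∀ p ∈ e.source, HasWirtinger e
      (fun q => extendedSolution ψ₀ β l k q * reversedProduct φ₀ α l 1 i q) p 0 0 := by
    intro e he p hp
    have hlm : l * l⁻¹ = 1 := mul_inv_cancel₀ hl
    obtain ⟨c, d, hG⟩ := exists_hasWirtinger_reversedProduct hα he hp le_rfl l 1
    have hF := hasWirtinger_extendedSolution hα he hp le_rfl hlm
    have hS := hasWirtinger_extendedSolution hβ he hp le_rfl hlm
    -- The coefficients depend only on the map, so both extended solutions satisfy the same linear
    -- equations.
    rw [← h] at hS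
    have hFG := hF.mul hp hG
    rw [funext fun q => extendedSolution_mul_reversedProduct φ₀ α (mul_one l).symm i q] at hFG
    have hc := hasWirtinger_const e (l ^ i • (1 : Endo n)) p
    have hGF := reversedProduct_mul_extendedSolution φ₀ α (mul_one l).symm i p
    refine (hS.mul hp hG).congr_deriv ?_ ?_
    · exact mul_add_mul_eq_zero (pow_ne_zero i hl) hGF (hFG.dz_eq.symm.trans hc.dz_eq)
    · exact mul_add_mul_eq_zero (pow_ne_zero i hl) hGF (hFG.dzbar_eq.symm.trans hc.dzbar_eq)
  exact eq_of_fderiv_eq_zero (fun e he p hp => (key e he p hp).diff)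
    (fun e he p hp => (key e he p hp).fderiv_eq_zero) p q

end Extended

/-! ### Division by powers of the loop parameter. -/

section Division

/-- An entire function divisible by `l ^ i` in the weak sense provided by a jointly full family of
right factors is divisible by `l ^ i`. -/
theorem exists_eq_pow_smul {𝔸 ι : Type*} [NormedRing 𝔸] [NormedAlgebra ℂ 𝔸] [CompleteSpace 𝔸]
    {F Ψ : ι → ℂ → 𝔸} (hF : ∀ p, Continuous (F p)) (hΨ : ∀ p, Continuous (Ψ p))
    (hfull : ∀ R : 𝔸, (∀ p, R * F p 0 = 0) → R = 0) (i : ℕ) {P : ℂ → 𝔸} (hP : Differentiable ℂ P)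
    (h : ∀ p l, l ≠ 0 → P l * F p l = l ^ i • Ψ p l) :
    ∃ Q : ℂ → 𝔸, Differentiable ℂ Q ∧ ∀ l, P l = l ^ i • Q l := by
  induction i generalizing P with
  | zero => exact ⟨P, hP, fun l => by simp⟩
  | succ i ih =>
    have h0 : P 0 = 0 := by
      -- By continuity the relation persists at `l = 0`, where its right side vanishes.
      refine hfull _ fun p => ?_
      have h1 := Continuous.ext_on (dense_compl_singleton (0 : ℂ)) (hP.continuous.mul (hF p))
        ((continuous_id.pow (i + 1)).smul (hΨ p)) fun l hl => h p l hl
      simpa using congrFun h1 0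
    -- As `P 0 = 0`, `dslope P 0` is `P l / l` with the removable singularity at `0` filled in.
    have hD : Differentiable ℂ (dslope P 0) :=
      differentiableOn_univ.1
        ((Complex.differentiableOn_dslope Filter.univ_mem).2 hP.differentiableOn)
    have hPD (l : ℂ) : P l = l • dslope P 0 l := by
      simpa [h0] using (sub_smul_dslope P 0 l).symm
    obtain ⟨Q, hQ, hPQ⟩ := ih hD fun p l hl => by
      have h1 := h p l hl
      rw [hPD, smul_mul_assoc, pow_succ', mul_smul] at h1
      exact smul_right_injective 𝔸 hl h1
    exact ⟨Q, hQ, fun l => by rw [hPD, hPQ, smul_smul, pow_succ']⟩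

end Division

/-! ### Consequences of the covering condition at `l = 0`. -/

section Covering

variable {n : ℕ} {M : Type*}

/-- Under the covering condition at `p`, the value at `l = 0` of the extended solution has the
range `φ₀ α_1`. -/
theorem exists_extendedSolution_zero_eq (φ₀ : UGroup n) {α : ℕ → M → Submodule ℂ (Vec n)} {i : ℕ}
    {p : M} (hp : ∀ ℓ, 2 ≤ ℓ → ℓ ≤ i →
      (α ℓ p).map ((α (ℓ - 1) p).starProjection : Vec n →ₗ[ℂ] Vec n) = α (ℓ - 1) p)
    {v : Vec n} (hv : v ∈ α 1 p) {ℓ : ℕ} (h1 : 1 ≤ ℓ) (hℓ : ℓ ≤ i) :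
    ∃ w ∈ α ℓ p, extendedSolution φ₀ α 0 ℓ p w = (φ₀ : Endo n) v := by
  have hfix (ℓ : ℕ) (w : Vec n) (hw : w ∈ α (ℓ + 1) p) :
      extendedSolution φ₀ α 0 (ℓ + 1) p w = extendedSolution φ₀ α 0 ℓ p w := by
    simp [extendedSolution, Submodule.starProjection_eq_self_iff.2 hw]
  have hproj (ℓ : ℕ) (w : Vec n) :
      extendedSolution φ₀ α 0 (ℓ + 1) p ((α (ℓ + 1) p).starProjection w)
      = extendedSolution φ₀ α 0 (ℓ + 1) p w := by
    have h : (α (ℓ + 1) p).starProjection ((α (ℓ + 1) p).starProjection w)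
        = (α (ℓ + 1) p).starProjection w :=
      Submodule.starProjection_eq_self_iff.2 (Submodule.starProjection_apply_mem _ w)
    simp [extendedSolution, h]
  induction ℓ, h1 using Nat.le_induction with
  | base => exact ⟨v, hv, hfix 0 v hv⟩
  | succ ℓ h1 ih =>
    obtain ⟨w, hw, hwv⟩ := ih (Nat.le_of_succ_le hℓ)
    have hc := hp (ℓ + 1) (by omega) hℓ
    rw [Nat.add_sub_cancel] at hc
    -- Covering lifts `w` to some `u` in the next bundle with `π_ℓ u = w`; at `l = 0` the last
    -- factor is `π_ℓ`, so `u` and `w` have the same image.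
    rw [← hc] at hw
    obtain ⟨u, hu, rfl⟩ := hw
    obtain ⟨j, rfl⟩ := Nat.exists_eq_add_of_le' h1
    refine ⟨u, hu, ?_⟩
    rw [hfix _ u hu, ← hwv]
    exact (hproj j u).symm

/-- Under the covering condition at `p`, the adjoint of the value at `0` of the reversed product
is injective on the orthogonal complement of the last bundle. -/
theorem star_reversedProduct_zero_apply_ne_zero (φ₀ : UGroup n) {α : ℕ → M → Submodule ℂ (Vec n)}
    {i : ℕ} {p : M} (hp : ∀ ℓ, 2 ≤ ℓ → ℓ ≤ i →
      (α ℓ p).map ((α (ℓ - 1) p).starProjection : Vec n →ₗ[ℂ] Vec n) = α (ℓ - 1) p)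
    {ℓ : ℕ} (h1 : 1 ≤ ℓ) (hℓ : ℓ ≤ i) {v : Vec n} (hv : v ∈ (α ℓ p)ᗮ) (hv0 : v ≠ 0) :
    star (reversedProduct φ₀ α 0 1 ℓ p) v ≠ 0 := by
  have hstep (ℓ : ℕ) (w : Vec n) : star (reversedProduct φ₀ α 0 1 (ℓ + 1) p) w
      = star (reversedProduct φ₀ α 0 1 ℓ p) ((α (ℓ + 1) p)ᗮ.starProjection w) := by
    have h : star ((1 : ℂ) • (1 : Endo n) + ((0 : ℂ) - 1) • (α (ℓ + 1) p).starProjection)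
        = (α (ℓ + 1) p)ᗮ.starProjection := by
      rw [← (isSelfAdjoint_starProjection (α (ℓ + 1) p)ᗮ).star_eq]
      congr 1
      ext1 v
      simp [sub_eq_add_neg]
    have h2 : star (reversedProduct φ₀ α 0 1 (ℓ + 1) p) = star (reversedProduct φ₀ α 0 1 ℓ p) *
        (α (ℓ + 1) p)ᗮ.starProjection := by
      rw [← h]; exact star_mul _ _
    rw [h2]; rfl
  induction ℓ, h1 using Nat.le_induction generalizing v with
  | base =>
    rw [hstep 0, Submodule.starProjection_eq_self_iff.2 hv]
    intro h
    have h2 : star (star (φ₀ : Endo n)) v = 0 := h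
    rw [star_star] at h2
    have h3 : (star (φ₀ : Endo n) * (φ₀ : Endo n)) v = 0 := by
      change star (φ₀ : Endo n) ((φ₀ : Endo n) v) = 0
      rw [h2, map_zero]
    rw [Unitary.coe_star_mul_self] at h3
    exact hv0 h3
  | succ ℓ h1 ih =>
    have hc := hp (ℓ + 1) (by omega) hℓ
    rw [Nat.add_sub_cancel] at hc
    obtain ⟨j, rfl⟩ := Nat.exists_eq_add_of_le' h1
    rw [hstep (j + 1), Submodule.starProjection_eq_self_iff.2 hv, hstep j]
    -- Otherwise `v` lies in `α_ℓ = π_ℓ α_{ℓ+1}`, say `v = π_ℓ u`, and `⟨v, v⟩ = ⟨u, π_ℓ v⟩ = ⟨u, v⟩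
    -- = 0` because `v ⊥ α_{ℓ+1}`.
    have hne : (α (j + 1) p)ᗮ.starProjection v ≠ 0 := by
      intro h
      rw [Submodule.starProjection_orthogonal_val, sub_eq_zero] at h
      have hmem : v ∈ α (j + 1) p := Submodule.starProjection_eq_self_iff.1 h.symm
      rw [← hc] at hmem
      obtain ⟨u, hu, huv⟩ := hmem
      have h2 : inner ℂ v v = 0 := by
        have huv' : v = (α (j + 1) p).starProjection u := huv.symm
        nth_rewrite 1 [huv']
        rw [Submodule.inner_starProjection_left_eq_right, ← h]
        exact hv u hu
      exact hv0 (inner_self_eq_zero.1 h2)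
    have := ih (Nat.le_of_succ_le hℓ) (Submodule.starProjection_apply_mem _ v) hne
    rwa [hstep j, Submodule.starProjection_eq_self_iff.2
      (Submodule.starProjection_apply_mem _ v)] at this

variable [TopologicalSpace M]

theorem IsCovering.eventually {α : ℕ → M → Submodule ℂ (Vec n)} {i : ℕ} (h : IsCovering α i) :
    ∀ᶠ p in Filter.codiscrete M, ∀ ℓ, 2 ≤ ℓ → ℓ ≤ i →
      (α ℓ p).map ((α (ℓ - 1) p).starProjection : Vec n →ₗ[ℂ] Vec n) = α (ℓ - 1) p := by
  have h1 := (Filter.eventually_all_finset (Finset.Icc 2 i)).2 fun ℓ hℓ =>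
    h ℓ (Finset.mem_Icc.1 hℓ).1 (Finset.mem_Icc.1 hℓ).2
  exact h1.mono fun p hp ℓ h2 h3 => hp ℓ (Finset.mem_Icc.2 ⟨h2, h3⟩)

variable [ChartedSpace ℂ M]

/-- On the dense set where covering holds, `R φ₀` kills `α_1`; by continuity it does so everywhere,
and its kernel is a constant subbundle containing the full bundle `α_1`. -/
theorem eq_zero_of_mul_extendedSolution_zero {φ₀ : UGroup n}
    {α : ℕ → M → Submodule ℂ (Vec n)} {i : ℕ} (hi : 1 ≤ i) (hα : IsUnitonSequence φ₀ α i)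
    (hcover : IsCovering α i) (hfull : IsFull (α 1)) {R : Endo n}
    (hR : ∀ p, R * extendedSolution φ₀ α 0 i p = 0) : R = 0 := by
  set S : Endo n := R * (φ₀ : Endo n) with hS
  have hcont : Continuous fun p => S * (α 1 p).starProjection :=
    continuous_const.mul ((hα 0 hi).subbundle.continuous)
  have hz := hcont.ext_on (dense_of_mem_codiscrete hcover.eventually) continuous_const
    (g := fun _ => (0 : Endo n)) fun p hp => by
      ext1 v
      obtain ⟨w, -, hw⟩ := exists_extendedSolution_zero_eq φ₀ hp
        (Submodule.starProjection_apply_mem (α 1 p) v) hi le_rfl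
      change R ((φ₀ : Endo n) ((α 1 p).starProjection v)) = 0
      rw [← hw]
      exact DFunLike.congr_fun (hR p) w
  have htop := hfull (LinearMap.ker (S : Vec n →ₗ[ℂ] Vec n)) fun p v hv => by
    have h1 := DFunLike.congr_fun (congrFun hz p) v
    change S ((α 1 p).starProjection v) = 0 at h1
    rw [Submodule.starProjection_eq_self_iff.2 hv] at h1
    exact h1
  have hS0 : S = 0 := by
    ext1 v
    have : v ∈ LinearMap.ker (S : Vec n →ₗ[ℂ] Vec n) := htop ▸ Submodule.mem_top
    exact this
  have h1 : S * star (φ₀ : Endo n) = R := by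
    have h2 : (φ₀ : Endo n) * star (φ₀ : Endo n) = 1 := Unitary.coe_mul_star_self φ₀
    rw [hS, mul_assoc, h2, mul_one]
  rw [← h1, hS0, zero_mul]

/-- The points where `α_i` is proper form a nonempty open set, which meets the dense set where
covering holds. There the adjoint of `G_0` is nonzero on nonzero vectors of `α_i^⊥`. -/
theorem exists_reversedProduct_zero_ne_zero {φ₀ : UGroup n}
    {α : ℕ → M → Submodule ℂ (Vec n)} {i : ℕ} (hi : 1 ≤ i) (hα : IsUnitonSequence φ₀ α i)
    (hcover : IsCovering α i) (hproper : ∃ p, α i p ≠ ⊤) :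
    ∃ p, reversedProduct φ₀ α 0 1 i p ≠ 0 := by
  obtain ⟨j, rfl⟩ := Nat.exists_eq_add_of_le' hi
  have htop (p : M) : α (j + 1) p ≠ ⊤ ↔ (α (j + 1) p).starProjection ≠ (1 : Endo n) := by
    rw [not_iff_not]
    constructor
    · intro h
      ext1 v
      exact Submodule.starProjection_eq_self_iff.2 (h ▸ Submodule.mem_top)
    · intro h
      rw [Submodule.eq_top_iff']
      intro v
      rw [← Submodule.starProjection_eq_self_iff, h]
      rfl
  have hopen : IsOpen {p | α (j + 1) p ≠ ⊤} := by
    simp only [htop]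
    exact isOpen_ne_fun (hα j j.lt_succ_self).subbundle.continuous continuous_const
  obtain ⟨p, hp, hcov⟩ :=
    (dense_of_mem_codiscrete hcover.eventually).inter_open_nonempty _ hopen hproper
  refine ⟨p, fun h0 => ?_⟩
  obtain ⟨v, hv, hv0⟩ := Submodule.exists_mem_ne_zero_of_ne_bot
    (fun h => hp (Submodule.orthogonal_eq_bot_iff.1 h))
  refine star_reversedProduct_zero_apply_ne_zero φ₀ hcov hi le_rfl hv hv0 ?_
  have h1 : star (0 : Endo n) = 0 := star_zero (Endo n)
  rw [h0, h1]
  rfl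

end Covering

/-! ### The lower bound and the theorem. -/

/-- The number of factors in a factorization of a map with a full covering sequence of `i` proper
unitons is at least `i`. -/
theorem le_of_flagProduct_eq {M : Type*} [TopologicalSpace M] [ConnectedSpace M] [ChartedSpace ℂ M]
    [IsManifold 𝓘(ℝ, ℂ) ∞ M] {n i k : ℕ} {φ₀ ψ₀ : UGroup n}
    {α β : ℕ → M → Submodule ℂ (Vec n)} (hi : 1 ≤ i)
    (hα : IsUnitonSequence φ₀ α i) (hβ : IsUnitonSequence ψ₀ β k)
    (h : flagProduct φ₀ α i = flagProduct ψ₀ β k) (hcover : IsCovering α i)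
    (hproper : ∃ p, α i p ≠ ⊤) (hfull : IsFull (α 1)) : i ≤ k := by
  by_contra! hki
  obtain ⟨p₀, hp₀⟩ := exists_reversedProduct_zero_ne_zero hi hα hcover hproper
  have hFG (l : ℂ) (p : M) := reversedProduct_mul_extendedSolution φ₀ α (mul_one l).symm i p
  have hGS (l : ℂ) := reversedProduct_mul_extendedSolution ψ₀ β (mul_one l).symm k p₀
  obtain ⟨Q, hQ, hPQ⟩ := exists_eq_pow_smul
    (F := fun p l => extendedSolution φ₀ α l i p) (Ψ := fun p l => extendedSolution ψ₀ β l k p)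
    (fun p => (differentiable_extendedSolution φ₀ α i p).continuous)
    (fun p => (differentiable_extendedSolution ψ₀ β k p).continuous)
    (fun R hR => eq_zero_of_mul_extendedSolution_zero hi hα hcover hfull hR) i
    (P := fun l => extendedSolution ψ₀ β l k p₀ * reversedProduct φ₀ α l 1 i p₀)
    ((differentiable_extendedSolution ψ₀ β k p₀).mul (differentiable_reversedProduct φ₀ α i p₀))
    (fun p l hl => by
      rw [extendedSolution_mul_reversedProduct_const hα hβ h hl p₀ p, mul_assoc, hFG,
        mul_smul_comm, mul_one])
  have hcont : Continuous fun l => l ^ (i - k) • (reversedProduct ψ₀ β l 1 k p₀ * Q l) :=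
    (continuous_id.pow _).smul
      ((differentiable_reversedProduct ψ₀ β k p₀).continuous.mul hQ.continuous)
  -- For `l ≠ 0`, multiply `P(l) = l ^ i Q(l)` by the reversed product of `β` and cancel `l ^ k`;
  -- continuity extends the identity to `l = 0`.
  have heq := hcont.ext_on (dense_compl_singleton (0 : ℂ))
    (differentiable_reversedProduct φ₀ α i p₀).continuous fun l hl => by
      refine smul_right_injective (Endo n) (pow_ne_zero k hl) ?_
      have h1 := congrArg (reversedProduct ψ₀ β l 1 k p₀ * ·) (hPQ l)
      simp only [← mul_assoc] at h1
      rw [hGS, smul_mul_assoc, one_mul, mul_smul_comm] at h1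
      change l ^ k • l ^ (i - k) • _ = l ^ k • _
      rw [h1, smul_smul, ← pow_add, Nat.add_sub_cancel' hki.le]
  have h0 := congrFun heq 0
  simp only [zero_pow (Nat.sub_ne_zero_of_lt hki)] at h0
  exact hp₀ (h0.symm.trans (zero_smul ℂ (_ : Endo n)))

end

end UnitonTheory

theorem mainTheorem8 {M : Type*} [TopologicalSpace M] [T2Space M] [ConnectedSpace M]
    [ChartedSpace ℂ M] [IsManifold 𝓘(ℂ) ω M]
    (n i : ℕ) (φ₀ : UnitonTheory.UGroup n)
    (α : ℕ → M → Submodule ℂ (UnitonTheory.Vec n))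
    (hα : UnitonTheory.IsUnitonSequence φ₀ α i)
    (hcover : UnitonTheory.IsCovering α i)
    (hproper : ∀ ℓ, 1 ≤ ℓ → ℓ ≤ i → ∃ p, α ℓ p ≠ ⊤)
    (hfull : 1 ≤ i → UnitonTheory.IsFull (α 1)) :
    UnitonTheory.HasUnitonNumber (UnitonTheory.flagProduct φ₀ α i) i := by
  refine ⟨⟨φ₀, α, hα, rfl⟩, ?_⟩
  rintro k ⟨ψ₀, β, hβ, h⟩
  rcases Nat.eq_zero_or_pos i with rfl | hi
  · exact Nat.zero_le k
  · have := UnitonTheory.isManifold_real (M := M)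
    exact UnitonTheory.le_of_flagProduct_eq hi hα hβ h hcover (hproper i hi le_rfl) (hfull hi)
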